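/- Let $R$ be an associative ring with identity and let $M$ be a unital right $R$-module. Call $M$ - *quasi-injective* if every homomorphism from a submodule $N$ of $M$ to $M$ extends to an endomorphism of $M$; - *automorphism invariant* if, for its injective hull $E(M)\supseteq M$, one has $\varphi(M)\subseteq M$ for every automorphism $\varphi$ of $E(M)$; - *continuous* if every submodule of $M$ is essential in a direct summand of $M$, and every submodule of $M$ that is isomorphic to a direct summand of $M$ is itself a direct summand of $M$. Then $M$ is both continuous and automorphism invariant if and only if $M$ is quasi-injective. -/

import Mathlib

namespace ModuleInvariance

universe u v w

/-- `N` is an essential submodule of the submodule `K`: `N ≤ K`, and `N` meets every nonzero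
submodule of `K` nontrivially. -/
def IsEssentialIn {S : Type u} [Ring S] {M : Type v} [AddCommGroup M] [Module S M]
    (N K : Submodule S M) : Prop :=
  N ≤ K ∧ ∀ L : Submodule S M, L ≤ K → L ≠ ⊥ → N ⊓ L ≠ ⊥

/-- `K` is a direct summand of `M`: there is a submodule `K'` with `M = K ⊕ K'`. -/
def IsDirectSummand {S : Type u} [Ring S] {M : Type v} [AddCommGroup M] [Module S M]
    (K : Submodule S M) : Prop :=
  ∃ K' : Submodule S M, IsCompl K K'

/-- `M` is quasi-injective: every homomorphism from a submodule `N` of `M` to `M` extends to an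
endomorphism of `M`. -/
def IsQuasiInjective (S : Type u) [Ring S] (M : Type v) [AddCommGroup M] [Module S M] : Prop :=
  ∀ (N : Submodule S M) (f : N →ₗ[S] M), ∃ g : M →ₗ[S] M, ∀ x : N, g x = f x

/-- The embedding `i : M → E` exhibits `E` as an injective hull of `M`: `E` is an injective module
and the image of `M` is essential in `E`.

The class `Module.Injective` tests against the modules in the universe of `E`. That universe
contains the universe of `S` here, so that this is injectivity in the full sense (it is equivalent
to Baer's criterion). -/
structure IsInjectiveHull {S : Type u} [Ring S] {M : Type v} [AddCommGroup M] [Module S M]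
    {E : Type (max u w)} [AddCommGroup E] [Module S E] (i : M →ₗ[S] E) : Prop where
  injective_map : Function.Injective i
  injective_module : Module.Injective S E
  essential : IsEssentialIn (LinearMap.range i) ⊤

/-- `M` is automorphism invariant: `M` is mapped into itself by every automorphism of its injective
hull. An injective hull of `M` exists in the universe `max u v` and is unique up to an isomorphism
over `M`; the definition refers to all of them. -/
def IsAutomorphismInvariant (S : Type u) [Ring S] (M : Type v) [AddCommGroup M] [Module S M] :
    Prop :=
  ∀ (E : Type (max u v)) [AddCommGroup E] [Module S E] (i : M →ₗ[S] E), IsInjectiveHull i →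
    ∀ φ : E ≃ₗ[S] E, ∀ m : M, φ (i m) ∈ LinearMap.range i

/-- `M` is continuous: every submodule of `M` is essential in a direct summand of `M`, and every
submodule of `M` that is isomorphic to a direct summand of `M` is a direct summand of `M`. -/
structure IsContinuousModule (S : Type u) [Ring S] (M : Type v) [AddCommGroup M] [Module S M] :
    Prop where
  essential_in_summand : ∀ N : Submodule S M,
    ∃ K : Submodule S M, IsDirectSummand K ∧ IsEssentialIn N K
  summand_of_equiv : ∀ N K : Submodule S M, IsDirectSummand K → Nonempty (N ≃ₗ[S] K) →
    IsDirectSummand N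

end ModuleInvariance

namespace ModuleInvariance

/-! ### Essentiality, direct summands and quasi-injectivity -/

section Summands

variable {S : Type*} [Ring S] {M : Type*} [AddCommGroup M] [Module S M]

/-! For the main direction let `E` be an injective hull of `M`. If every endomorphism of `E`
preserves `M`, then `M` is quasi-injective: extend `N → M → E` to `E` and restrict to `M`.
Automorphism invariance says that units of `End E` preserve `M`; continuity makes idempotents
preserve it (`idempotent_apply_mem_range`). It remains to generate `End E` as a ring by units and
idempotents (`subring_eq_top_of_isUnit_of_isIdempotentElem`). For this, `E` splits as two isomorphic
summands and a square-free one (`exists_corner_decomposition`). Square-zero elements and the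
isomorphism handle all but the square-free corner, where `exists_eq_unit_mul_add` applies. -/

theorem IsEssentialIn.exists_smul_mem {N K : Submodule S M} (h : IsEssentialIn N K) {x : M}
    (hx : x ∈ K) (hx0 : x ≠ 0) : ∃ s : S, s • x ∈ N ∧ s • x ≠ 0 := by
  obtain ⟨y, hy, hy0⟩ := Submodule.exists_mem_ne_zero_of_ne_bot
    (h.2 (Submodule.span S {x}) (by simpa using hx) (by simpa using hx0))
  obtain ⟨hyN, hyx⟩ := Submodule.mem_inf.1 hy
  obtain ⟨s, rfl⟩ := Submodule.mem_span_singleton.1 hyx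
  exact ⟨s, hyN, hy0⟩

theorem isEssentialIn_of_forall_exists_smul_mem {N K : Submodule S M} (hNK : N ≤ K)
    (h : ∀ x ∈ K, x ≠ 0 → ∃ s : S, s • x ∈ N ∧ s • x ≠ 0) : IsEssentialIn N K := by
  refine ⟨hNK, fun L hL hL0 hbot => ?_⟩
  obtain ⟨x, hx, hx0⟩ := Submodule.exists_mem_ne_zero_of_ne_bot hL0
  obtain ⟨s, hs, hs0⟩ := h x (hL hx) hx0
  exact hs0 ((Submodule.mem_bot S).1 (hbot ▸ Submodule.mem_inf.2 ⟨hs, L.smul_mem s hx⟩))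

theorem isDirectSummand_iff_exists_projection {K : Submodule S M} :
    IsDirectSummand K ↔ ∃ e : M →ₗ[S] M, (∀ x, e x ∈ K) ∧ ∀ x ∈ K, e x = x := by
  constructor
  · rintro ⟨K', h⟩
    exact ⟨K.projection K' h, fun x => Submodule.projection_apply_mem h x,
      fun x hx => Submodule.projection_apply_of_mem_left h hx⟩
  · rintro ⟨e, he, he'⟩
    exact ⟨_, LinearMap.isCompl_of_proj (f := e.codRestrict K he)
      fun x => Subtype.ext (he' x x.2)⟩

theorem exists_le_maximal_disjoint {N A : Submodule S M} (h : Disjoint N A) :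
    ∃ B, A ≤ B ∧ Maximal (Disjoint N) B := by
  refine zorn_le_nonempty₀ {B | Disjoint N B} (fun c hc hchain y hy => ?_) A h
  refine ⟨sSup c, ?_, fun z hz => le_sSup hz⟩
  exact hchain.directedOn.disjoint_sSup_right.2 fun b hb => hc hb

namespace IsQuasiInjective

theorem exists_eq_self_and_eq_zero (hM : IsQuasiInjective S M) {K N : Submodule S M}
    (h : Disjoint K N) : ∃ g : M →ₗ[S] M, (∀ x ∈ K, g x = x) ∧ ∀ x ∈ N, g x = 0 := by
  let k : M →ₗ.[S] M := ⟨K, K.subtype⟩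
  let n : M →ₗ.[S] M := ⟨N, 0⟩
  have H := LinearPMap.sup_h_of_disjoint k n h
  obtain ⟨g, hg⟩ := hM _ (k.sup n H).toFun
  refine ⟨g, fun x hx => ?_, fun x hx => ?_⟩
  · have h1 := hg ⟨x, Submodule.mem_sup_left hx⟩
    have h2 := LinearPMap.sup_apply H ⟨x, hx⟩ 0 ⟨x, Submodule.mem_sup_left hx⟩ (by simp)
    exact h1.trans (h2.trans (by simp [k]))
  · have h1 := hg ⟨x, Submodule.mem_sup_right hx⟩
    have h2 := LinearPMap.sup_apply H 0 ⟨x, hx⟩ ⟨x, Submodule.mem_sup_right hx⟩ (by simp)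
    exact h1.trans (h2.trans (by simp [n]))

/-- Take `N'` maximal disjoint from `N`, then `K ≥ N` maximal disjoint from `N'`. An extension of
the projection `K ⊕ N' → K` to `M` has range disjoint from `N'`, so maximality of `K` puts that
range inside `K`. -/
theorem isContinuousModule (hM : IsQuasiInjective S M) : IsContinuousModule S M where
  essential_in_summand N := by
    obtain ⟨N', -, hN'⟩ := exists_le_maximal_disjoint (disjoint_bot_right (a := N))
    obtain ⟨K, hNK, hK⟩ := exists_le_maximal_disjoint hN'.prop.symm
    have key : ∀ L ≤ K, L ≠ ⊥ → N ⊓ L ≠ ⊥ := by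
      intro L hL hL0 hbot
      refine hL0 (le_bot_iff.1 (hK.prop ?_ hL))
      have hdisj : Disjoint N (N' ⊔ L) := by
        rw [Submodule.disjoint_def]
        intro x hx hx'
        obtain ⟨y, hy, z, hz, rfl⟩ := Submodule.mem_sup.1 hx'
        have hy0 : y = 0 := Submodule.disjoint_def.1 hK.prop y hy
          (by simpa using K.sub_mem (hNK hx) (hL hz))
        subst hy0
        rw [zero_add] at hx ⊢
        exact (Submodule.mem_bot S).1 (hbot ▸ Submodule.mem_inf.2 ⟨hx, hz⟩)
      exact le_sup_right.trans (hN'.le_of_ge hdisj le_sup_left)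
    refine ⟨K, ?_, hNK, key⟩
    obtain ⟨g, hgK, hgN⟩ := hM.exists_eq_self_and_eq_zero hK.prop.symm
    rw [isDirectSummand_iff_exists_projection]
    refine ⟨g, fun x => ?_, hgK⟩
    have hcomap : N'.comap g ≤ N' := by
      refine hN'.le_of_ge (Submodule.disjoint_def.2 fun y hy hy' => ?_)
        fun y hy => by simp [hgN y hy]
      rw [Submodule.mem_comap, hgK y (hNK hy)] at hy'
      exact Submodule.disjoint_def.1 hN'.prop y hy hy'
    have hrange : LinearMap.range g ≤ K := by
      refine hK.le_of_ge (Submodule.disjoint_def.2 ?_) fun y hy => ⟨y, hgK y hy⟩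
      rintro _ hy ⟨y, rfl⟩
      exact hgN y (hcomap hy)
    exact hrange ⟨x, rfl⟩
  summand_of_equiv N K hK := by
    rintro ⟨e⟩
    obtain ⟨p, hp, hp'⟩ := isDirectSummand_iff_exists_projection.1 hK
    obtain ⟨g, hg⟩ := hM N (K.subtype ∘ₗ e.toLinearMap)
    rw [isDirectSummand_iff_exists_projection]
    refine ⟨N.subtype ∘ₗ e.symm.toLinearMap ∘ₗ (p ∘ₗ g).codRestrict K fun x => hp _,
      fun x => by simp, fun x hx => ?_⟩
    have h : (p ∘ₗ g).codRestrict K (fun x => hp _) x = e ⟨x, hx⟩ := by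
      ext
      simp only [LinearMap.codRestrict_apply, LinearMap.comp_apply]
      rw [hg ⟨x, hx⟩]
      exact hp' _ (e ⟨x, hx⟩).2
    simp [h]

theorem of_retract (hM : IsQuasiInjective S M) {Y : Type*} [AddCommGroup Y] [Module S Y]
    (i : Y →ₗ[S] M) (p : M →ₗ[S] Y) (hpi : ∀ y, p (i y) = y) : IsQuasiInjective S Y := by
  intro N f
  obtain ⟨g, hg⟩ := hM (N.comap p) (i ∘ₗ f ∘ₗ p.submoduleComap N)
  refine ⟨p ∘ₗ g ∘ₗ i, fun x => ?_⟩
  have h := hg ⟨i x, by simp [hpi]⟩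
  have h2 : p.submoduleComap N ⟨i x, by simp [hpi]⟩ = x := Subtype.ext (hpi x)
  simp only [LinearMap.comp_apply] at h ⊢
  rw [h, h2, hpi]

/-- Extend to `g` the part of `φ` that sends `M` into `M`. If `(φ - g) m ≠ 0`, a nonzero multiple of
it lies in `M`; then `φ (s • m)` lies in `M`, where `φ` and `g` agree, a contradiction. -/
theorem isAutomorphismInvariant (hM : IsQuasiInjective S M) : IsAutomorphismInvariant S M := by
  intro E _ _ i hi φ m
  have hinj := hi.injective_map
  let j := LinearEquiv.ofInjective i hinj
  let f : M →ₗ[S] E := φ.toLinearMap ∘ₗ i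
  obtain ⟨g, hg⟩ := hM ((LinearMap.range i).comap f)
    (j.symm.toLinearMap ∘ₗ f.submoduleComap (LinearMap.range i))
  have hg' : ∀ x, f x ∈ LinearMap.range i → i (g x) = f x := by
    intro x hx
    rw [hg ⟨x, hx⟩]
    exact congrArg Subtype.val (j.apply_symm_apply (f.submoduleComap _ ⟨x, hx⟩))
  by_cases h0 : f m - i (g m) = 0
  · exact ⟨g m, (sub_eq_zero.1 h0).symm⟩
  · obtain ⟨s, ⟨n, hn⟩, hs⟩ := hi.essential.exists_smul_mem (Submodule.mem_top) h0
    refine absurd ?_ hs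
    have hmem : f (s • m) ∈ LinearMap.range i :=
      ⟨n + g (s • m), by rw [map_add, hn]; simp [smul_sub]⟩
    have := hg' _ hmem
    rw [smul_sub, ← map_smul, ← map_smul, ← map_smul, this, sub_self]

end IsQuasiInjective

end Summands

end ModuleInvariance

namespace ModuleInvariance

/-! ### Endomorphisms of square-free quasi-injective modules -/

section Clean

variable {S : Type*} [Ring S]

/-- A partially defined endomorphism is displacing if it is injective and its domain meets its
range trivially. -/
def IsDisplacing {M : Type*} [AddCommGroup M] [Module S M] (g : M →ₗ.[S] M) : Prop :=
  ∀ x y : g.domain, g x = y → (x : M) = 0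

/-- A module is square-free if it contains no two nonzero isomorphic submodules with trivial
intersection. -/
def IsSquareFree (S : Type*) [Ring S] (M : Type*) [AddCommGroup M] [Module S M] : Prop :=
  ∀ g : M →ₗ.[S] M, IsDisplacing g → g.domain = ⊥

section SquareFree

variable {Y : Type*} [AddCommGroup Y] [Module S Y]

/-- The range is isomorphic to `Y`, hence has a complement `Z`. Since `u` carries `Z` into the
range, `u` restricted to `Z` is displacing, so `Z = 0`. -/
theorem IsSquareFree.isUnit_of_injective (hsf : IsSquareFree S Y) (hY : IsQuasiInjective S Y)
    {u : Module.End S Y} (hu : Function.Injective u) : IsUnit u := by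
  rw [Module.End.isUnit_iff]
  refine ⟨hu, ?_⟩
  obtain ⟨Z, hZ⟩ : IsDirectSummand (LinearMap.range u) :=
    hY.isContinuousModule.summand_of_equiv _ ⊤ ⟨⊥, isCompl_top_bot⟩
      ⟨(LinearEquiv.ofInjective u hu).symm.trans Submodule.topEquiv.symm⟩
  have hbot : Z = ⊥ := by
    refine hsf ⟨Z, u ∘ₗ Z.subtype⟩ fun x y hxy => ?_
    have hxy' : u x = y := hxy
    have hy : (y : Y) = 0 := Submodule.disjoint_def.1 hZ.disjoint y ⟨x, hxy'⟩ y.2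
    exact hu (by rw [hxy', hy, map_zero])
  subst hbot
  exact LinearMap.range_eq_top.1 (eq_top_of_isCompl_bot hZ)

/-- Let `h` project onto a summand in which `ker f` is essential. Then `p = 1 - h`, `u = f (1 - h) +
h` and `v = 1 - f h` work: square-freeness makes `u` injective, essentiality makes `v` injective. -/
theorem IsSquareFree.exists_eq_unit_mul_add (hsf : IsSquareFree S Y) (hY : IsQuasiInjective S Y)
    (f : Module.End S Y) : ∃ u v p : Module.End S Y,
      IsUnit u ∧ IsUnit v ∧ IsIdempotentElem p ∧ f = u * p + (1 - v) := by
  obtain ⟨H, hH, hess⟩ := hY.isContinuousModule.essential_in_summand (LinearMap.ker f)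
  obtain ⟨(h : Module.End S Y), hh, hh'⟩ := isDirectSummand_iff_exists_projection.1 hH
  have hidem : IsIdempotentElem h := LinearMap.ext fun x => hh' _ (hh x)
  have hu : Function.Injective (f * (1 - h) + h : Module.End S Y) := by
    have hA := hsf ⟨LinearMap.ker h ⊓ H.comap f, f ∘ₗ Submodule.subtype _⟩ fun x y hxy => by
      have hxy' : f x = y := hxy
      have hx := Submodule.mem_inf.1 x.2
      have hy : h y = 0 := (Submodule.mem_inf.1 y.2).1
      have hfx : f x = 0 := by rw [← hh' _ hx.2, hxy', hy]
      rw [← hh' x (hess.1 hfx)]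
      exact hx.1
    rw [injective_iff_map_eq_zero]
    intro x hx
    have hx' : f (x - h x) + h x = 0 := hx
    have hmem : x - h x ∈ LinearMap.ker h ⊓ H.comap f := by
      refine Submodule.mem_inf.2 ⟨by simp [hh' _ (hh x)], ?_⟩
      rw [Submodule.mem_comap, eq_neg_of_add_eq_zero_left hx']
      exact H.neg_mem (hh x)
    have hxx : x - h x = 0 := (Submodule.mem_bot S).1 (hA ▸ hmem)
    rw [hxx, map_zero, zero_add] at hx'
    rwa [hx', sub_zero] at hxx
  have hv : Function.Injective (1 - f * h : Module.End S Y) := by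
    rw [injective_iff_map_eq_zero]
    intro x hx
    have hx' : x = f (h x) := sub_eq_zero.1 hx
    by_contra hx0
    obtain ⟨s, hs, hs0⟩ := hess.exists_smul_mem (hh x)
      fun h0 => hx0 (by rw [hx', h0, map_zero])
    refine hs0 ?_
    rw [← map_smul, hx', ← map_smul, LinearMap.mem_ker.1 hs, map_zero]
  refine ⟨_, _, 1 - h, hsf.isUnit_of_injective hY hu, hsf.isUnit_of_injective hY hv,
    hidem.one_sub, ?_⟩
  rw [add_mul, mul_assoc, hidem.one_sub.eq, mul_sub h, hidem.eq]
  noncomm_ring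

end SquareFree

end Clean

end ModuleInvariance

namespace ModuleInvariance

/-! ### Generating the endomorphism ring by units and idempotents -/

section Generation

variable {S : Type*} [Ring S] {E : Type*} [AddCommGroup E] [Module S E]

theorem exists_maximal_isDisplacing :
    ∃ g : E →ₗ.[S] E, Maximal IsDisplacing g := by
  have hbot : IsDisplacing (⊥ : E →ₗ.[S] E) := fun x _ _ => (Submodule.mem_bot S).1 x.2
  refine (zorn_le_nonempty₀ {g : E →ₗ.[S] E | IsDisplacing g} (fun c hc hchain g₀ hg₀ => ?_)
    ⊥ hbot).imp fun g hg => hg.2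
  refine ⟨LinearPMap.sSup c hchain.directedOn, fun x y hxy => ?_,
    fun z hz => LinearPMap.le_sSup _ hz⟩
  obtain ⟨f₁, hf₁, hx⟩ := (LinearPMap.mem_domain_sSup_iff ⟨g₀, hg₀⟩ hchain.directedOn).1 x.2
  obtain ⟨f₂, hf₂, hy⟩ := (LinearPMap.mem_domain_sSup_iff ⟨g₀, hg₀⟩ hchain.directedOn).1 y.2
  obtain ⟨f, hf, h₁, h₂⟩ := hchain.directedOn f₁ hf₁ f₂ hf₂
  refine hc hf ⟨x, h₁.1 hx⟩ ⟨y, h₂.1 hy⟩ ?_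
  rw [← hxy]
  exact (LinearPMap.le_sSup hchain.directedOn hf).2 rfl

/-- The domain of a maximal displacing partial endomorphism of a quasi-injective module is a direct
summand. -/
theorem isDirectSummand_domain_of_maximal (hE : IsQuasiInjective S E) {g : E →ₗ.[S] E}
    (hg : Maximal IsDisplacing g) : IsDirectSummand g.domain := by
  obtain ⟨K, hK, hess⟩ := hE.isContinuousModule.essential_in_summand g.domain
  obtain ⟨(G : Module.End S E), hG⟩ := hE g.domain g.toFun
  -- A violation on `K` can be scaled into the essential submodule `g.domain`, so maximality forces
  -- `K = g.domain`.
  have hdis : IsDisplacing (⟨K, G ∘ₗ K.subtype⟩ : E →ₗ.[S] E) := by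
    intro x y hxy
    have hxy' : G x = y := hxy
    by_contra hx0
    obtain ⟨s, hs, hs0⟩ := hess.exists_smul_mem x.2 hx0
    by_cases hy0 : s • (y : E) = 0
    · refine hs0 (hg.prop ⟨s • x, hs⟩ 0 ?_)
      have := hG ⟨s • x, hs⟩
      simp only [map_smul, hxy', hy0] at this
      exact this.symm
    · obtain ⟨t, ht, ht0⟩ := hess.exists_smul_mem (K.smul_mem s y.2) hy0
      have h0 := hg.prop ⟨t • s • x, Submodule.smul_mem _ t hs⟩ ⟨_, ht⟩ (by
        have := hG ⟨t • s • x, Submodule.smul_mem _ t hs⟩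
        simp only [map_smul, hxy'] at this
        exact this.symm)
      refine ht0 ?_
      rw [← hxy', ← map_smul, ← map_smul]
      exact (congrArg G h0).trans (map_zero G)
  have hle : K ≤ g.domain :=
    (hg.le_of_ge hdis ⟨hess.1, fun x y hxy => by
      have h : G x = g x := hG x
      exact h.symm.trans (congrArg G hxy)⟩).1
  rwa [le_antisymm hess.1 hle]

/-- For a maximal displacing `g`, `e` projects onto its domain and kills its range, `a` acts as `g`,
and `b` inverts it. A nonzero displacing map in the remaining summand could be adjoined to `g`. -/
theorem exists_corner_decomposition (hE : IsQuasiInjective S E) :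
    ∃ e a b : Module.End S E, IsIdempotentElem e ∧ e * a = 0 ∧ a * e = a ∧ e * b = b ∧
      b * e = 0 ∧ b * a = e ∧ IsSquareFree S (LinearMap.range (1 - e - a * b)) := by
  obtain ⟨g, hg⟩ := exists_maximal_isDisplacing (S := S) (E := E)
  obtain ⟨(p : Module.End S E), hp, hp'⟩ :=
    isDirectSummand_iff_exists_projection.1 (isDirectSummand_domain_of_maximal hE hg)
  have hdisj : Disjoint g.domain (LinearMap.range g.toFun) := by
    rw [Submodule.disjoint_def]
    rintro _ hy ⟨x, rfl⟩
    have hx : x = 0 := Subtype.ext (hg.prop x ⟨_, hy⟩ rfl)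
    rw [hx, map_zero]
  have hinj : Function.Injective g.toFun := by
    rw [injective_iff_map_eq_zero]
    exact fun x hx => Subtype.ext (hg.prop x 0 hx)
  obtain ⟨(r : Module.End S E), hr, hr'⟩ := hE.exists_eq_self_and_eq_zero hdisj
  obtain ⟨(G : Module.End S E), hG⟩ := hE g.domain g.toFun
  obtain ⟨(h : Module.End S E), hh⟩ := hE (LinearMap.range g.toFun)
    (g.domain.subtype ∘ₗ (LinearEquiv.ofInjective g.toFun hinj).symm.toLinearMap)
  let e : Module.End S E := p * r
  have he : ∀ x, e x ∈ g.domain := fun x => hp _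
  have heD : ∀ x ∈ g.domain, e x = x := fun x hx => by
    change p (r x) = x
    rw [hr x hx, hp' x hx]
  have heg : ∀ x : g.domain, e (g x) = 0 := fun x => by
    change p (r (g x)) = 0
    rw [hr' (g x) ⟨x, rfl⟩, map_zero]
  have hGg : ∀ x (hx : x ∈ g.domain), G x = g ⟨x, hx⟩ := fun x hx => hG ⟨x, hx⟩
  have hhg : ∀ x : g.domain, h (g x) = x := fun x => by
    have := hh ⟨g x, x, rfl⟩
    refine this.trans ?_
    exact congrArg Subtype.val ((LinearEquiv.ofInjective g.toFun hinj).symm_apply_apply x)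
  have hidem : IsIdempotentElem e := LinearMap.ext fun x => heD _ (he x)
  have hee : e * e = e := hidem
  have hea : e * (G * e) = 0 := LinearMap.ext fun x => by
    change e (G (e x)) = 0
    rw [hGg _ (he x), heg]
  have hba : e * h * (1 - e) * (G * e) = e := by
    rw [mul_assoc, sub_mul, hea, one_mul, sub_zero]
    refine LinearMap.ext fun x => ?_
    change e (h (G (e x))) = e x
    rw [hGg _ (he x), hhg, heD _ (he x)]
  have heb : e * (e * h * (1 - e)) = e * h * (1 - e) := by
    rw [← mul_assoc, ← mul_assoc, hee]
  have hbe : e * h * (1 - e) * e = 0 := by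
    rw [mul_assoc, sub_mul, one_mul, hee, sub_self, mul_zero]
  refine ⟨e, G * e, e * h * (1 - e), hidem, hea, by rw [mul_assoc, hee], heb, hbe, hba, ?_⟩
  set a := G * e with ha
  set b := e * h * (1 - e) with hb
  have hbg : ∀ x : g.domain, b (g x) = x := fun x => by
    have := LinearMap.congr_fun hba x
    change b (G (e x)) = e x at this
    rwa [heD x x.2, hGg x x.2] at this
  have heq : e * (1 - e - a * b) = 0 := by
    rw [mul_sub, mul_sub, ← mul_assoc e a b, hea, hee, mul_one, zero_mul, sub_self, sub_zero]
  have hbq : b * (1 - e - a * b) = 0 := by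
    rw [mul_sub, mul_sub, ← mul_assoc b a b, hba, hbe, heb, mul_one, sub_zero, sub_self]
  have heY : ∀ y : LinearMap.range (1 - e - a * b), e y = 0 := by
    rintro ⟨_, x, rfl⟩
    exact LinearMap.congr_fun heq x
  have hbY : ∀ y : LinearMap.range (1 - e - a * b), b y = 0 := by
    rintro ⟨_, x, rfl⟩
    exact LinearMap.congr_fun hbq x
  intro k hk
  let ι := (LinearMap.range (1 - e - a * b)).subtype
  let j := Submodule.equivMapOfInjective ι (Submodule.subtype_injective _) k.domain
  let k' : E →ₗ.[S] E := ⟨k.domain.map ι, ι ∘ₗ k.toFun ∘ₗ j.symm.toLinearMap⟩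
  have hk'dom : ∀ x : k'.domain, e x = 0 ∧ b x = 0 := by
    rintro ⟨_, y, -, rfl⟩
    exact ⟨heY y, hbY y⟩
  have hk'ran : ∀ x : k'.domain, e (k' x) = 0 ∧ b (k' x) = 0 := fun x => ⟨heY _, hbY _⟩
  have hk' : IsDisplacing k' := by
    intro x y hxy
    obtain ⟨x, rfl⟩ := j.surjective x
    obtain ⟨y, rfl⟩ := j.surjective y
    have hxy' : ι (k (j.symm (j x))) = ι (y : _) := hxy
    rw [j.symm_apply_apply] at hxy'
    have := hk x y (Subtype.ext hxy')
    change ι x = 0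
    rw [this, map_zero]
  have hd : Disjoint g.domain k'.domain := Submodule.disjoint_def.2 fun x hx hx' => by
    rw [← heD x hx]
    exact (hk'dom ⟨x, hx'⟩).1
  have H := LinearPMap.sup_h_of_disjoint g k' hd
  have hsup : IsDisplacing (g.sup k' H) := by
    intro x y hxy
    obtain ⟨d, hd, z, hz, hx⟩ := Submodule.mem_sup.1 x.2
    obtain ⟨d', hd', z', hz', hy⟩ := Submodule.mem_sup.1 y.2
    rw [LinearPMap.sup_apply H ⟨d, hd⟩ ⟨z, hz⟩ x hx, ← hy] at hxy
    -- In `g d + k' z = d' + z'`, applying `e` gives `d' = 0`, then applying `b` gives `d = 0`.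
    have h1 := congrArg e hxy
    rw [map_add, map_add, heg, (hk'ran _).1, heD d' hd', (hk'dom ⟨z', hz'⟩).1, add_zero,
      add_zero] at h1
    subst h1
    rw [zero_add] at hxy
    have h2 := congrArg b hxy
    rw [map_add, hbg, (hk'ran _).2, (hk'dom ⟨z', hz'⟩).2, add_zero] at h2
    have h2' : d = 0 := h2
    subst h2'
    have h3 : g ⟨0, hd⟩ = 0 := map_zero g.toFun
    rw [h3, zero_add] at hxy
    rw [← hx, zero_add]
    exact hk' ⟨z, hz⟩ ⟨z', hz'⟩ hxy
  have hle : k'.domain ≤ g.domain :=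
    (LinearPMap.right_le_sup g k' H).1.trans (hg.le_of_ge hsup (LinearPMap.left_le_sup g k' H)).1
  rw [eq_bot_iff]
  intro y hy
  have hy' : ι y ∈ k'.domain := ⟨y, hy, rfl⟩
  exact (Submodule.mem_bot S).2 (Subtype.ext (Submodule.disjoint_def.1 hd _ (hle hy') hy'))

/-- The endomorphism ring of a quasi-injective module is generated by units and idempotents. -/
theorem subring_eq_top_of_isUnit_of_isIdempotentElem (hE : IsQuasiInjective S E)
    (T : Subring (Module.End S E)) (hunit : ∀ u, IsUnit u → u ∈ T)
    (hidem : ∀ e, IsIdempotentElem e → e ∈ T) : T = ⊤ := by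
  have hsq : ∀ n, n * n = 0 → n ∈ T := fun n hn => by
    have h : 1 + n ∈ T := hunit _ ⟨⟨1 + n, 1 - n, by noncomm_ring; simp [hn],
      by noncomm_ring; simp [hn]⟩, rfl⟩
    simpa using T.sub_mem h T.one_mem
  have hoff : ∀ e, IsIdempotentElem e → ∀ f, e * f * (1 - e) ∈ T := fun e he f => by
    refine hsq _ ?_
    have : (1 - e) * e = 0 := by rw [sub_mul, one_mul, he.eq, sub_self]
    rw [mul_assoc, mul_assoc, mul_assoc, ← mul_assoc (1 - e), this]
    simp
  have hoff' : ∀ e, IsIdempotentElem e → ∀ f, (1 - e) * f * e ∈ T := fun e he f => by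
    simpa using hoff _ he.one_sub f
  obtain ⟨e, a, b, he, hea, hae, heb, hbe, hba, hsf⟩ := exists_corner_decomposition hE
  have haT : a ∈ T := by
    have := hoff' e he a
    rwa [sub_mul, one_mul, hea, sub_zero, hae] at this
  have hbT : b ∈ T := by
    have := hoff e he b
    rwa [mul_sub, mul_one, mul_assoc, hbe, mul_zero, sub_zero, heb] at this
  have hefe : ∀ f, e * f * e ∈ T := fun f => by
    -- As `b * a = e`, a diagonal corner element is a product of two off-diagonal ones.
    have h := T.mul_mem (hoff e he (f * b)) haT
    have h2 : e * (f * b) * (1 - e) * a = e * f * e := by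
      rw [mul_assoc _ (1 - e), sub_mul, one_mul, hea, sub_zero]
      simp only [mul_assoc, hba]
    rwa [h2] at h
  have hef : ∀ f, e * f ∈ T := fun f => by
    have := T.add_mem (hefe f) (hoff e he f)
    rwa [← mul_add, add_sub_cancel, mul_one] at this
  have hfe : ∀ f, f * e ∈ T := fun f => by
    have := T.add_mem (hefe f) (hoff' e he f)
    rwa [← add_mul, ← add_mul, add_sub_cancel, one_mul] at this
  set q := 1 - e - a * b with hq
  have hqq : IsIdempotentElem q := by
    have h1 : e * q = 0 := by
      rw [hq, mul_sub, mul_sub, ← mul_assoc e a b, hea, he.eq, mul_one, zero_mul, sub_self,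
        sub_zero]
    have h2 : b * q = 0 := by
      rw [hq, mul_sub, mul_sub, ← mul_assoc b a b, hba, hbe, heb, mul_one, sub_zero, sub_self]
    change q * q = q
    nth_rw 1 [hq]
    rw [sub_mul, sub_mul, h1, mul_assoc, h2, one_mul, mul_zero, sub_zero, sub_zero]
  have hqapply : ∀ x, q (q x) = q x := fun x => LinearMap.congr_fun hqq x
  have hqf : ∀ f, (1 - q) * f ∈ T := fun f => by
    have := T.add_mem (hef f) (T.mul_mem haT (hef (b * f)))
    rwa [← mul_assoc e b f, heb, ← mul_assoc a b f, ← add_mul,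
      show e + a * b = 1 - q by rw [hq]; abel] at this
  have hfq : ∀ f, f * (1 - q) ∈ T := fun f => by
    have := T.add_mem (hfe f) (T.mul_mem (hfe (f * a)) hbT)
    rwa [mul_assoc (f * a) e b, heb, mul_assoc f a b, ← mul_add,
      show e + a * b = 1 - q by rw [hq]; abel] at this
  -- the corner at `q`
  let ι : LinearMap.range q →ₗ[S] E := (LinearMap.range q).subtype
  let p : E →ₗ[S] LinearMap.range q := q.rangeRestrict
  have hpι : ∀ y, p (ι y) = y := by
    rintro ⟨_, x, rfl⟩
    exact Subtype.ext (hqapply x)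
  have hmul : ∀ s t : Module.End S (LinearMap.range q),
      ((ι ∘ₗ s ∘ₗ p : Module.End S E)) * (ι ∘ₗ t ∘ₗ p : Module.End S E) =
        (ι ∘ₗ (s * t) ∘ₗ p : Module.End S E) := fun s t => by
    refine LinearMap.ext fun x => ?_
    change ι (s (p (ι (t (p x))))) = ι (s (t (p x)))
    rw [hpι]
  have hone : (ι ∘ₗ (1 : Module.End S (LinearMap.range q)) ∘ₗ p : Module.End S E) = q := rfl
  have hcorner_idem : ∀ s : Module.End S (LinearMap.range q), IsIdempotentElem s →
      (ι ∘ₗ s ∘ₗ p : Module.End S E) ∈ T := fun s hs => by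
    refine hidem _ ?_
    change _ * _ = _
    rw [hmul, hs.eq]
  have hcorner_unit : ∀ s : Module.End S (LinearMap.range q), IsUnit s →
      (ι ∘ₗ s ∘ₗ p : Module.End S E) ∈ T := by
    rintro _ ⟨s, rfl⟩
    have hl : ∀ t : Module.End S (LinearMap.range q),
        (ι ∘ₗ t ∘ₗ p : Module.End S E) * (1 - q) = 0 := fun t => by
      rw [mul_sub, mul_one, sub_eq_zero]
      exact (hmul t 1).symm
    have hr : ∀ t : Module.End S (LinearMap.range q),
        (1 - q) * (ι ∘ₗ t ∘ₗ p : Module.End S E) = 0 := fun t => by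
      rw [sub_mul, one_mul, sub_eq_zero]
      exact (hmul 1 t).symm
    -- A unit of the corner becomes a unit of `End E` after adding the idempotent `1 - q`.
    have hinv : ∀ t t' : Module.End S (LinearMap.range q), t * t' = 1 →
        ((ι ∘ₗ t ∘ₗ p : Module.End S E) + (1 - q)) * (ι ∘ₗ t' ∘ₗ p + (1 - q)) = 1 := by
      intro t t' h
      rw [add_mul, mul_add, mul_add, hl, hr, hmul, h, hone, hqq.one_sub.eq]
      abel
    have hT := hunit _ ⟨⟨_, _, hinv _ _ s.mul_inv, hinv _ _ s.inv_mul⟩, rfl⟩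
    simpa using T.sub_mem hT (hidem _ hqq.one_sub)
  rw [eq_top_iff]
  intro f _
  have hY : IsQuasiInjective S (LinearMap.range q) := hE.of_retract ι p hpι
  obtain ⟨u, v, r, hu, hv, hr, huvr⟩ := hsf.exists_eq_unit_mul_add hY (p ∘ₗ f ∘ₗ ι)
  have hqfq : q * f * q ∈ T := by
    have h1 : q * f * q = (ι ∘ₗ (p ∘ₗ f ∘ₗ ι) ∘ₗ p : Module.End S E) := rfl
    have h2 : (ι ∘ₗ (u * r + (1 - v)) ∘ₗ p : Module.End S E) =
        ι ∘ₗ (u * r) ∘ₗ p + (ι ∘ₗ 1 ∘ₗ p - ι ∘ₗ v ∘ₗ p) := by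
      simp only [LinearMap.comp_add, LinearMap.add_comp, LinearMap.comp_sub, LinearMap.sub_comp]
    rw [h1, huvr, h2, ← hmul, hone]
    exact T.add_mem (T.mul_mem (hcorner_unit u hu) (hcorner_idem r hr))
      (T.sub_mem (hidem q hqq) (hcorner_unit v hv))
  have := T.add_mem (T.add_mem (hqf f) (hfq (q * f))) hqfq
  rwa [add_assoc, ← mul_add, sub_add_cancel, mul_one, ← add_mul, sub_add_cancel, one_mul] at this

end Generation

end ModuleInvariance

namespace ModuleInvariance

universe u v

/-! ### Continuous modules are preserved by idempotents of an essential extension -/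

section Invariance

variable {S : Type*} [Ring S] {M : Type*} [AddCommGroup M] [Module S M]

namespace IsContinuousModule

/-- With `p` a projection onto `A`, one has `A ⊕ B = A ⊕ (1 - p) B`, and `(1 - p) B ≅ B` is again a
summand. -/
theorem isDirectSummand_sup (hM : IsContinuousModule S M) {A B : Submodule S M}
    (hA : IsDirectSummand A) (hB : IsDirectSummand B) (hAB : Disjoint A B) :
    IsDirectSummand (A ⊔ B) := by
  obtain ⟨(p : Module.End S M), hp, hp'⟩ := isDirectSummand_iff_exists_projection.1 hA
  have hinj : Function.Injective ((1 - p) ∘ₗ B.subtype) := by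
    rw [injective_iff_map_eq_zero]
    intro x hx
    have hx' : (x : M) = p x := sub_eq_zero.1 hx
    exact Subtype.ext (Submodule.disjoint_def.1 hAB x (hx' ▸ hp x) x.2)
  obtain ⟨r, hr, hr'⟩ := isDirectSummand_iff_exists_projection.1
    (hM.summand_of_equiv _ B hB ⟨(LinearEquiv.ofInjective _ hinj).symm⟩)
  have hmem : ∀ x, r x ∈ A ⊔ B := fun x => by
    obtain ⟨b, hb⟩ := hr x
    have hb' : (b : M) - p b = r x := hb
    rw [← hb']
    exact sub_mem (Submodule.mem_sup_right b.2) (Submodule.mem_sup_left (hp _))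
  rw [isDirectSummand_iff_exists_projection]
  refine ⟨p + r ∘ₗ (1 - p), fun x => add_mem (Submodule.mem_sup_left (hp x)) (hmem _), ?_⟩
  intro x hx
  obtain ⟨y, hy, z, hz, rfl⟩ := Submodule.mem_sup.1 hx
  have hr1 : r (z - p z) = z - p z := hr' _ ⟨⟨z, hz⟩, rfl⟩
  change p (y + z) + r (y + z - p (y + z)) = y + z
  rw [map_add, hp' y hy, add_sub_add_left_eq_sub, hr1]
  abel

variable {E : Type*} [AddCommGroup E] [Module S E] {i : M →ₗ[S] E}

/-- The kernel has no proper essential extension in `M`: if `e k ≠ 0` with `k ∈ K`, a nonzero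
multiple `m` of `e k` lies in `K`, but `e` fixes every multiple of `m`. -/
theorem isDirectSummand_ker_comp (hM : IsContinuousModule S M)
    (hinj : Function.Injective i) (hess : IsEssentialIn (LinearMap.range i) ⊤) {e : Module.End S E}
    (he : IsIdempotentElem e) : IsDirectSummand (LinearMap.ker (e ∘ₗ i)) := by
  obtain ⟨K, hK, hKess⟩ := hM.essential_in_summand (LinearMap.ker (e ∘ₗ i))
  suffices h : K ≤ LinearMap.ker (e ∘ₗ i) by rwa [le_antisymm hKess.1 h]
  intro k hk
  by_contra hk0
  obtain ⟨s, ⟨m, hm⟩, hs⟩ := hess.exists_smul_mem Submodule.mem_top hk0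
  have hee : ∀ x, e (e x) = e x := fun x => LinearMap.congr_fun he x
  have hm' : i m = e (i (s • k)) := by rw [hm]; simp
  have hsub : s • k - m ∈ LinearMap.ker (e ∘ₗ i) := by
    rw [LinearMap.mem_ker, LinearMap.comp_apply, map_sub, map_sub, hm', hee, sub_self]
  have hmK : m ∈ K := by simpa using K.sub_mem (K.smul_mem s hk) (hKess.1 hsub)
  have hm0 : m ≠ 0 := by
    rintro rfl
    exact hs (by rw [← hm, map_zero])
  obtain ⟨t, ht, ht0⟩ := hKess.exists_smul_mem hmK hm0
  have ht' : e (i (t • m)) = 0 := ht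
  rw [map_smul, map_smul, hm', hee, ← hm', ← map_smul] at ht'
  exact ht0 (hinj (ht'.trans (map_zero i).symm))

/-- `M ∩ eE` and `M ∩ ker e` are disjoint summands, so their sum has a complement `Z` in `M`. If `z
∈ Z` and `e z ≠ 0`, some nonzero `s • e z` lies in `M`, which puts `s • z` in the sum. Hence `Z = 0`
and `M` splits along `e`. -/
theorem idempotent_apply_mem_range (hM : IsContinuousModule S M)
    (hinj : Function.Injective i) (hess : IsEssentialIn (LinearMap.range i) ⊤)
    {e : Module.End S E} (he : IsIdempotentElem e) (m : M) : e (i m) ∈ LinearMap.range i := by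
  have hee : ∀ x, e (e x) = e x := fun x => LinearMap.congr_fun he x
  have hdisj : Disjoint (LinearMap.ker ((1 - e) ∘ₗ i)) (LinearMap.ker (e ∘ₗ i)) := by
    rw [Submodule.disjoint_def]
    intro x hx hx'
    have h1 : i x - e (i x) = 0 := hx
    have h2 : e (i x) = 0 := hx'
    exact hinj (by rw [map_zero, ← h1, h2, sub_zero])
  obtain ⟨Z, hZ⟩ := hM.isDirectSummand_sup (hM.isDirectSummand_ker_comp hinj hess he.one_sub)
    (hM.isDirectSummand_ker_comp hinj hess he) hdisj
  have hZ0 : Z = ⊥ := by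
    rw [eq_bot_iff]
    intro z hz
    refine Submodule.disjoint_def.1 hZ.disjoint z (Submodule.mem_sup_right ?_) hz
    by_contra hz0
    obtain ⟨s, ⟨x, hx⟩, hs⟩ := hess.exists_smul_mem Submodule.mem_top hz0
    have hx' : i x = e (i (s • z)) := by rw [hx]; simp
    refine hs ?_
    have hsz : s • z = 0 := by
      refine Submodule.disjoint_def.1 hZ.disjoint _ ?_ (Z.smul_mem s hz)
      rw [← add_sub_cancel x (s • z)]
      refine add_mem (Submodule.mem_sup_left ?_) (Submodule.mem_sup_right ?_)
      · change i x - e (i x) = 0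
        rw [hx', hee, sub_self]
      · change e (i (s • z - x)) = 0
        rw [map_sub, map_sub, hx', hee, sub_self]
    rw [← hx, hx', hsz, map_zero, map_zero]
  subst hZ0
  have hm : m ∈ LinearMap.ker ((1 - e) ∘ₗ i) ⊔ LinearMap.ker (e ∘ₗ i) := by
    rw [eq_top_of_isCompl_bot hZ]
    exact Submodule.mem_top
  obtain ⟨a, ha, b, hb, rfl⟩ := Submodule.mem_sup.1 hm
  have ha' : i a = e (i a) := sub_eq_zero.1 ha
  have hb' : e (i b) = 0 := hb
  exact ⟨a, by rw [map_add, map_add, hb', ← ha', add_zero]⟩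

end IsContinuousModule

end Invariance

/-! ### Injective hulls and the converse direction -/

section Hull

theorem isQuasiInjective_of_injective {S : Type u} [Ring S] {E : Type (max u v)}
    [AddCommGroup E] [Module S E] (hE : Module.Injective S E) : IsQuasiInjective S E :=
  fun N f => hE.out N.subtype N.subtype_injective f

/-- The hull is a summand of an injective module containing `M`, chosen so that `M` is essential in
it. -/
theorem exists_isInjectiveHull (S : Type u) [Ring S] (M : Type v) [AddCommGroup M] [Module S M] :
    ∃ (E : Type (max u v)) (_ : AddCommGroup E) (_ : Module S E) (i : M →ₗ[S] E),
      IsInjectiveHull i := by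
  obtain ⟨P⟩ := (ModuleCat.enoughInjectives.{v} S).presentation
    (ModuleCat.of S (ULift.{max u v} M))
  have hP : Module.Injective S P.J := (Module.injective_iff_injective_object S P.J).2 P.injective
  let j : M →ₗ[S] P.J := P.f.hom ∘ₗ ULift.moduleEquiv.symm.toLinearMap
  have hj : Function.Injective j :=
    ((ModuleCat.mono_iff_injective P.f).1 P.mono).comp ULift.moduleEquiv.symm.injective
  obtain ⟨K, hK, hess⟩ :=
    (isQuasiInjective_of_injective.{u, v} hP).isContinuousModule.essential_in_summand
      (LinearMap.range j)
  obtain ⟨p, hp, hp'⟩ := isDirectSummand_iff_exists_projection.1 hK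
  refine ⟨K, inferInstance, inferInstance, j.codRestrict K fun x => hess.1 ⟨x, rfl⟩, ?_, ?_, ?_⟩
  · exact fun x y h => hj (congrArg Subtype.val h)
  · refine ⟨fun X Y _ _ _ _ f hf g => ?_⟩
    obtain ⟨h, hh⟩ := hP.out f hf (K.subtype ∘ₗ g)
    exact ⟨p.codRestrict K hp ∘ₗ h, fun x => Subtype.ext
      ((congrArg p (hh x)).trans (hp' _ (g x).2))⟩
  · refine isEssentialIn_of_forall_exists_smul_mem le_top fun x _ hx0 => ?_
    obtain ⟨s, ⟨m, hm⟩, hs⟩ := hess.exists_smul_mem x.2 fun h => hx0 (Subtype.ext h)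
    exact ⟨s, ⟨m, Subtype.ext hm⟩, fun h => hs (congrArg Subtype.val h)⟩

theorem IsContinuousModule.isQuasiInjective {S : Type u} [Ring S] {M : Type v} [AddCommGroup M]
    [Module S M] (hM : IsContinuousModule S M) (hA : IsAutomorphismInvariant S M) :
    IsQuasiInjective S M := by
  obtain ⟨E, _, _, i, hi⟩ := exists_isInjectiveHull S M
  let T : Subring (Module.End S E) :=
    { carrier := {f | ∀ x ∈ LinearMap.range i, f x ∈ LinearMap.range i}
      mul_mem' := fun hf hg x hx => hf _ (hg x hx)
      one_mem' := fun x hx => hx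
      add_mem' := fun hf hg x hx => add_mem (hf x hx) (hg x hx)
      zero_mem' := fun x _ => zero_mem _
      neg_mem' := fun hf x hx => neg_mem (hf x hx) }
  have hT : T = ⊤ := by
    refine subring_eq_top_of_isUnit_of_isIdempotentElem
      (isQuasiInjective_of_injective.{u, v} hi.injective_module) T ?_ ?_
    · rintro f hf _ ⟨m, rfl⟩
      exact hA E i hi (LinearEquiv.ofBijective f ((Module.End.isUnit_iff f).1 hf)) m
    · rintro e he _ ⟨m, rfl⟩
      exact hM.idempotent_apply_mem_range hi.injective_map hi.essential he m
  intro N f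
  obtain ⟨F, hF⟩ := (isQuasiInjective_of_injective.{u, v} hi.injective_module) (N.map i)
    (i ∘ₗ f ∘ₗ (Submodule.equivMapOfInjective i hi.injective_map N).symm.toLinearMap)
  have hFT : ∀ x ∈ LinearMap.range i, F x ∈ LinearMap.range i :=
    show (F : Module.End S E) ∈ T from hT ▸ Subring.mem_top _
  refine ⟨(LinearEquiv.ofInjective i hi.injective_map).symm.toLinearMap ∘ₗ
    (F ∘ₗ i).codRestrict (LinearMap.range i) fun x => hFT _ ⟨x, rfl⟩, fun x => ?_⟩
  refine (LinearEquiv.symm_apply_eq _).2 (Subtype.ext ?_)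
  have h := hF ⟨i x, x, x.2, rfl⟩
  refine h.trans ?_
  exact congrArg (fun y => i (f y))
    ((Submodule.equivMapOfInjective i hi.injective_map N).symm_apply_apply x)

end Hull

end ModuleInvariance

/-- A right module `M` over a ring `R` (that is, a module over the opposite ring) is both continuous
and automorphism invariant if and only if it is quasi-injective. -/
theorem mainTheorem6 (R : Type*) [Ring R] (M : Type*) [AddCommGroup M] [Module Rᵐᵒᵖ M] :
    (ModuleInvariance.IsContinuousModule Rᵐᵒᵖ M ∧
      ModuleInvariance.IsAutomorphismInvariant Rᵐᵒᵖ M) ↔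
      ModuleInvariance.IsQuasiInjective Rᵐᵒᵖ M := by
  exact ⟨fun h => h.1.isQuasiInjective h.2,
    fun h => ⟨h.isContinuousModule, h.isAutomorphismInvariant⟩⟩
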